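/- For $m\ge 0$ equip $\mathbb R^{2m}$ with coordinates $(x_1,\dots,x_m,y_1,\dots,y_m)$ and the standard symplectic form $\omega_0=\sum_{i=1}^m dx_i\wedge dy_i$, and let $B^{2m}(\rho)\subset\mathbb R^{2m}$ denote the Euclidean ball of radius $\rho$ centred at the origin; products carry the sum of the standard forms, so that $\mathbb R^{2}\times\mathbb R^{2(n-1)}$ and $\mathbb R^{4}\times\mathbb R^{2(n-2)}$ are both the standard $\mathbb R^{2n}$. A symplectic embedding of a subset $A$ into a subset $B$ is a map $A\to B$ that is the restriction of a smooth embedding $\varphi$, with $\varphi^*\omega_0=\omega_0$, of an open neighbourhood of $A$. **Theorem.** Let $n\ge 3$. For every $R>\sqrt3$ and every $S>0$ there exists a symplectic embedding of $B^2(1)\times B^{2(n-1)}(S)$ into $B^4(R)\times\mathbb R^{2(n-2)}$. (Here the balls $B^2(1)$ and $B^{2(n-1)}(S)$ may be taken closed and $B^4(R)$ open.) -/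

import Mathlib

open scoped ContDiff

/-- The Euclidean space `ℝ²ⁿ`; the coordinates of a point `p` are
`xᵢ = p (Sum.inl i)` and `yᵢ = p (Sum.inr i)`. -/
abbrev R2 (n : ℕ) : Type := EuclideanSpace ℝ (Fin n ⊕ Fin n)

/-- The standard symplectic form `ω₀ = ∑ᵢ dxᵢ ∧ dyᵢ` on `ℝ²ⁿ`. -/
def stdForm {n : ℕ} (u v : R2 n) : ℝ :=
  ∑ i : Fin n, (u (Sum.inl i) * v (Sum.inr i) - u (Sum.inr i) * v (Sum.inl i))

/-- The standard symplectic form of `ℝ²⁽ᵃ⁺ᵇ⁾ = ℝ²ᵃ × ℝ²ᵇ`, i.e. `ω₀ ⊕ ω₀`. -/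
def prodForm {a b : ℕ} (u v : R2 a × R2 b) : ℝ :=
  stdForm u.1 v.1 + stdForm u.2 v.2

/-- `φ` restricts to a symplectic embedding of the open set `U ⊆ ℝ²ᵃ × ℝ²ᵇ` into `ℝ²ᶜ × ℝ²ᵈ`:
it is smooth on `U`, pulls the standard symplectic form back to the standard symplectic form
(so it is an immersion), and is a homeomorphism of `U` onto its image. -/
structure IsSymplecticEmbeddingOn {a b c d : ℕ} (φ : R2 a × R2 b → R2 c × R2 d)
    (U : Set (R2 a × R2 b)) : Prop where
  isOpen : IsOpen U
  contDiffOn : ContDiffOn ℝ ∞ φ U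
  pullback_eq : ∀ p ∈ U, ∀ u v : R2 a × R2 b,
    prodForm (fderiv ℝ φ p u) (fderiv ℝ φ p v) = prodForm u v
  isEmbedding : Topology.IsEmbedding (U.domRestrict φ)

/-- There is a symplectic embedding of the subset `A` into the subset `B`. As usual for a set `A`
that need not be open, such an embedding is the restriction to `A` of a symplectic embedding of an
open neighbourhood of `A`; if `A` is open, the neighbourhood may be taken to be `A` itself. -/
def SymplecticallyEmbeds {a b c d : ℕ} (A : Set (R2 a × R2 b)) (B : Set (R2 c × R2 d)) : Prop :=
  ∃ (U : Set (R2 a × R2 b)) (φ : R2 a × R2 b → R2 c × R2 d),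
    A ⊆ U ∧ IsSymplecticEmbeddingOn φ U ∧ Set.MapsTo φ A B

/-!
Area-preserving coordinates turn the disc into a rectangle with coordinates `(s₁, t₁)`, where `s₁`
is an area divided by `2 * π`, and polar coordinates turn the ball `B⁴(R)` into the set
`s₁ + s₂ < R ^ 2 / 2`. One plane of the large factor is a long strip, which is wound many times
around a family of ellipses in the `(s₂, t₂)`-plane; the next plane has coordinates `(x, y)`. To
keep successive turns apart, the back half of each turn translates `x` by more than the diameter
of the large factor. On the front half a shear lifts `s₁` by the whole area of the disc above the
interval of `s₂` where this translation takes place, so that the back half passes underneath. The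
price of a shear is a displacement of `t₂`; since the slope of the lift as a function of `s₂` is
less than `1`, it stays within one full angle, and `s₁ + s₂` remains an increasing function of
`s₂` and hence bounded by its value at the end of the ellipses, where the lift is over.
-/

noncomputable section

open Real Set Filter Topology

section Steps

variable {f g : ℝ → ℝ} {a b α θ s : ℝ}

/-- `f` is a smooth step of height `α` across the interval `[a, b]`. -/
structure IsSmoothStep (f : ℝ → ℝ) (a b α : ℝ) : Prop where
  contDiff : ContDiff ℝ ∞ f
  eq_zero_of_le : ∀ s ≤ a, f s = 0
  eq_of_ge : ∀ s, b ≤ s → f s = α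

namespace IsSmoothStep

lemma differentiable (hf : IsSmoothStep f a b α) : Differentiable ℝ f :=
  hf.contDiff.differentiable (by simp)

lemma contDiff_deriv (hf : IsSmoothStep f a b α) : ContDiff ℝ ∞ (deriv f) :=
  (contDiff_infty_iff_deriv.1 hf.contDiff).2

lemma eventuallyEq_zero (hf : IsSmoothStep f a b α) (hs : s < a) : f =ᶠ[𝓝 s] fun _ => 0 := by
  filter_upwards [Iio_mem_nhds hs] with x hx using hf.eq_zero_of_le x (le_of_lt hx)

lemma eventuallyEq_const (hf : IsSmoothStep f a b α) (hs : b < s) : f =ᶠ[𝓝 s] fun _ => α := by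
  filter_upwards [Ioi_mem_nhds hs] with x hx using hf.eq_of_ge x (le_of_lt hx)

lemma deriv_eventuallyEq_zero (hf : IsSmoothStep f a b α) (hs : s < a) :
    deriv f =ᶠ[𝓝 s] fun _ => 0 :=
  (hf.eventuallyEq_zero hs).deriv.trans (by simp)

lemma deriv_eventuallyEq_zero_of_gt (hf : IsSmoothStep f a b α) (hs : b < s) :
    deriv f =ᶠ[𝓝 s] fun _ => 0 :=
  (hf.eventuallyEq_const hs).deriv.trans (by simp)

lemma mem_Icc_of_deriv_ne_zero (hf : IsSmoothStep f a b α) (hs : deriv f s ≠ 0) :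
    s ∈ Icc a b :=
  ⟨not_lt.1 fun h => hs (hf.deriv_eventuallyEq_zero h).eq_of_nhds,
    not_lt.1 fun h => hs (hf.deriv_eventuallyEq_zero_of_gt h).eq_of_nhds⟩

lemma mem_Icc (hf : IsSmoothStep f a b α) (hmono : Monotone f) (s : ℝ) : f s ∈ Icc 0 α := by
  rw [← hf.eq_zero_of_le _ (min_le_right s a), ← hf.eq_of_ge _ (le_max_right s b)]
  exact ⟨hmono (min_le_left s a), hmono (le_max_left s b)⟩

end IsSmoothStep

lemma isSmoothStep_primitive (hg : ContDiff ℝ ∞ g) (hga : ∀ s ≤ a, g s = 0)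
    (hgb : ∀ s, b ≤ s → g s = 0) :
    IsSmoothStep (fun s => ∫ x in a..s, g x) a b (∫ x in a..b, g x) where
  contDiff := by
    rw [contDiff_infty_iff_deriv, funext (hg.continuous.deriv_integral g a)]
    exact ⟨fun s => (hg.continuous.integral_hasStrictDerivAt a s).hasDerivAt.differentiableAt, hg⟩
  eq_zero_of_le s hs :=
    intervalIntegral.integral_zero_ae (.of_forall fun x hx => hga x (by
      rw [uIoc_of_ge hs] at hx; exact hx.2))
  eq_of_ge s hs := by
    have htail : ∫ x in b..s, g x = 0 :=
      intervalIntegral.integral_zero_ae (.of_forall fun x hx => hgb x (by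
        rw [uIoc_of_le hs] at hx; exact hx.1.le))
    rw [← intervalIntegral.integral_add_adjacent_intervals
      (hg.continuous.intervalIntegrable a b) (hg.continuous.intervalIntegrable b s), htail,
      add_zero]

lemma two_mul_rIn_le_integral_bump {c : ℝ} (φ : ContDiffBump c) :
    2 * φ.rIn ≤ ∫ x in (c - φ.rOut)..(c + φ.rOut), φ x := by
  have hin := φ.rIn_pos
  have hio := φ.rIn_lt_rOut
  calc 2 * φ.rIn = ∫ _ in (c - φ.rIn)..(c + φ.rIn), (1 : ℝ) := by
        rw [integral_one]; ring
    _ = ∫ x in (c - φ.rIn)..(c + φ.rIn), φ x := by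
        refine intervalIntegral.integral_congr fun x hx => (φ.one_of_mem_closedBall ?_).symm
        rwa [uIcc_of_le (by linarith), ← Real.closedBall_eq_Icc] at hx
    _ ≤ ∫ x in (c - φ.rOut)..(c + φ.rOut), φ x :=
        intervalIntegral.integral_mono_interval (by linarith) (by linarith) (by linarith)
          (.of_forall fun _ => φ.nonneg) (φ.continuous.intervalIntegrable _ _)

lemma exists_contDiff_integral_eq (hab : a < b) (hα : 0 ≤ α) (h : α < θ * (b - a)) :
    ∃ g : ℝ → ℝ, ContDiff ℝ ∞ g ∧ (∀ s ≤ a, g s = 0) ∧ (∀ s, b ≤ s → g s = 0) ∧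
      (∀ s, g s ∈ Icc 0 θ) ∧ ∫ x in a..b, g x = α := by
  have hθ : 0 < θ := pos_of_mul_pos_left (hα.trans_lt h) (sub_pos.2 hab).le
  have hwidth : α / θ / 2 < (b - a) / 2 := by
    rw [div_lt_div_iff_of_pos_right two_pos, div_lt_iff₀ hθ, mul_comm]
    exact h
  obtain ⟨r, hr, hrb⟩ := exists_between hwidth
  have hr0 : 0 < r := (by positivity : 0 ≤ α / θ / 2).trans_lt hr
  let φ : ContDiffBump ((a + b) / 2) := ⟨r, (b - a) / 2, hr0, hrb⟩
  set I := ∫ x in a..b, φ x with hI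
  have hrI : 2 * r ≤ I := by
    convert two_mul_rIn_le_integral_bump φ using 2 <;> simp only [φ] <;> ring
  have hI0 : 0 < I := by linarith
  have hslope : α / I ≤ θ := by
    rw [div_le_iff₀ hI0, mul_comm, ← div_le_iff₀ hθ]
    linarith
  refine ⟨fun s => α / I * φ s, contDiff_const.mul φ.contDiff, fun s hs => ?_, fun s hs => ?_,
    fun s => ⟨mul_nonneg (by positivity) φ.nonneg,
      (mul_le_of_le_one_right (by positivity) φ.le_one).trans hslope⟩, ?_⟩
  · simp only
    rw [φ.zero_of_le_dist (by rw [Real.dist_eq, le_abs]; right; simp only [φ]; linarith), mul_zero]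
  · simp only
    rw [φ.zero_of_le_dist (by rw [Real.dist_eq, le_abs]; left; simp only [φ]; linarith), mul_zero]
  · rw [intervalIntegral.integral_const_mul, ← hI, div_mul_cancel₀ _ hI0.ne']

lemma exists_isSmoothStep_deriv_mem_Icc (hab : a < b) (hα : 0 ≤ α) (h : α < θ * (b - a)) :
    ∃ f, IsSmoothStep f a b α ∧ ∀ s, deriv f s ∈ Icc 0 θ := by
  obtain ⟨g, hg, hga, hgb, hgθ, rfl⟩ := exists_contDiff_integral_eq hab hα h
  refine ⟨_, isSmoothStep_primitive hg hga hgb, fun s => ?_⟩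
  rw [hg.continuous.deriv_integral]
  exact hgθ s

lemma isSmoothStep_smoothTransition (hab : a < b) (α : ℝ) :
    IsSmoothStep (fun s => α * Real.smoothTransition ((s - a) / (b - a))) a b α where
  contDiff := contDiff_const.mul
    (Real.smoothTransition.contDiff.comp ((contDiff_id.sub contDiff_const).div_const _))
  eq_zero_of_le s hs := by
    rw [Real.smoothTransition.zero_of_nonpos
      (div_nonpos_of_nonpos_of_nonneg (by linarith) (by linarith)), mul_zero]
  eq_of_ge s hs := by
    rw [Real.smoothTransition.one_of_one_le ((one_le_div (by linarith)).2 (by linarith)), mul_one]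

end Steps

section Slices

variable {ρ x y x' y' : ℝ}

/-- The area of the part of the disc of radius `ρ` to the left of the abscissa `x`, divided by
`2 * π`. With `sliceAngle` it forms area-preserving coordinates which turn the disc into a
rectangle. -/
def sliceArea (ρ x : ℝ) : ℝ := (∫ u in -ρ..x, √(ρ ^ 2 - u ^ 2)) / π

/-- The height of the point `(x, y)` in its vertical slice of the disc of radius `ρ`, normalized to
run through `(0, 2 * π)`. -/
def sliceAngle (ρ x y : ℝ) : ℝ := π * y / √(ρ ^ 2 - x ^ 2) + π

lemma hasDerivAt_sliceArea (ρ x : ℝ) : HasDerivAt (sliceArea ρ) (√(ρ ^ 2 - x ^ 2) / π) x :=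
  ((by fun_prop : Continuous fun u => √(ρ ^ 2 - u ^ 2)).integral_hasStrictDerivAt
    (-ρ) x).hasDerivAt.div_const π

lemma sliceArea_neg_self (ρ : ℝ) : sliceArea ρ (-ρ) = 0 := by simp [sliceArea]

lemma sliceArea_self (hρ : 0 < ρ) : sliceArea ρ ρ = ρ ^ 2 / 2 := by
  have hscale : ∀ u, √(ρ ^ 2 - u ^ 2) = ρ * √(1 - (u / ρ) ^ 2) := fun u => by
    rw [← Real.sqrt_sq hρ.le, ← Real.sqrt_mul (sq_nonneg ρ), Real.sqrt_sq hρ.le]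
    congr 1
    field_simp
  simp only [sliceArea, hscale, intervalIntegral.integral_const_mul]
  rw [intervalIntegral.integral_comp_div (fun u => √(1 - u ^ 2)) hρ.ne', neg_div,
    div_self hρ.ne', integral_sqrt_one_sub_sq, smul_eq_mul]
  field_simp

lemma sq_sub_sq_pos (hx : x ∈ Ioo (-ρ) ρ) : 0 < ρ ^ 2 - x ^ 2 := by
  nlinarith [hx.1, hx.2]

lemma strictMonoOn_sliceArea (ρ : ℝ) : StrictMonoOn (sliceArea ρ) (Icc (-ρ) ρ) := by
  refine strictMonoOn_of_deriv_pos (convex_Icc _ _)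
    (fun x _ => (hasDerivAt_sliceArea ρ x).continuousAt.continuousWithinAt) fun x hx => ?_
  rw [interior_Icc] at hx
  rw [(hasDerivAt_sliceArea ρ x).deriv]
  exact div_pos (Real.sqrt_pos.2 (sq_sub_sq_pos hx)) pi_pos

lemma sliceArea_mem_Ioo (hx : x ∈ Ioo (-ρ) ρ) : sliceArea ρ x ∈ Ioo 0 (ρ ^ 2 / 2) := by
  have hρ : 0 < ρ := by linarith [hx.1, hx.2]
  rw [← sliceArea_neg_self ρ, ← sliceArea_self hρ]
  have hmono := strictMonoOn_sliceArea ρ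
  exact ⟨hmono ⟨le_rfl, by linarith⟩ (Ioo_subset_Icc_self hx) hx.1,
    hmono (Ioo_subset_Icc_self hx) ⟨by linarith, le_rfl⟩ hx.2⟩

lemma contDiffOn_sliceArea (ρ : ℝ) : ContDiffOn ℝ ∞ (sliceArea ρ) (Ioo (-ρ) ρ) := by
  rw [contDiffOn_infty_iff_deriv_of_isOpen isOpen_Ioo,
    funext fun x => (hasDerivAt_sliceArea ρ x).deriv]
  refine ⟨fun x _ => (hasDerivAt_sliceArea ρ x).differentiableAt.differentiableWithinAt,
    ContDiffOn.div_const (ContDiffOn.sqrt (by fun_prop) fun x hx => (sq_sub_sq_pos hx).ne') π⟩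

lemma sliceAngle_mem_Ioo (h : x ^ 2 + y ^ 2 < ρ ^ 2) : sliceAngle ρ x y ∈ Ioo 0 (2 * π) := by
  have hroot : 0 < √(ρ ^ 2 - x ^ 2) := Real.sqrt_pos.2 (by nlinarith)
  have hratio : |y / √(ρ ^ 2 - x ^ 2)| < 1 := by
    rw [abs_div, abs_of_pos hroot, div_lt_one hroot]
    exact Real.lt_sqrt_of_sq_lt (by rw [sq_abs]; linarith)
  rw [abs_lt] at hratio
  rw [sliceAngle, mul_div_assoc]
  constructor <;> nlinarith [pi_pos]

lemma slice_injective (hx : x ∈ Ioo (-ρ) ρ) (hx' : x' ∈ Ioo (-ρ) ρ)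
    (hs : sliceArea ρ x = sliceArea ρ x') (ht : sliceAngle ρ x y = sliceAngle ρ x' y') :
    x = x' ∧ y = y' := by
  obtain rfl := (strictMonoOn_sliceArea ρ).injOn (Ioo_subset_Icc_self hx)
    (Ioo_subset_Icc_self hx') hs
  have hroot : √(ρ ^ 2 - x ^ 2) ≠ 0 := (Real.sqrt_pos.2 (sq_sub_sq_pos hx)).ne'
  simpa [sliceAngle, div_left_inj' hroot, pi_ne_zero] using ht

end Slices

section Polar

variable {s t s' t' : ℝ}

/-- The first coordinate of the point with symplectic polar coordinates `(s, t)`; the action `s` is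
half the squared radius, so that `ds ∧ dt` is the standard area form. -/
def polarX (s t : ℝ) : ℝ := √(2 * s) * cos t

/-- The second coordinate of the point with symplectic polar coordinates `(s, t)`. -/
def polarY (s t : ℝ) : ℝ := √(2 * s) * sin t

lemma polarX_sq_add_polarY_sq (hs : 0 ≤ s) (t : ℝ) : polarX s t ^ 2 + polarY s t ^ 2 = 2 * s := by
  rw [polarX, polarY, mul_pow, mul_pow, Real.sq_sqrt (by positivity), ← mul_add,
    cos_sq_add_sin_sq, mul_one]

lemma polar_injective (hs : 0 < s) (hs' : 0 < s') (hX : polarX s t = polarX s' t')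
    (hY : polarY s t = polarY s' t') : s = s' ∧ ∃ k : ℤ, t' = t + k * (2 * π) := by
  obtain rfl : s = s' := by
    have h := polarX_sq_add_polarY_sq hs.le t
    rw [hX, hY, polarX_sq_add_polarY_sq hs'.le] at h
    linarith
  have hroot : √(2 * s) ≠ 0 := (Real.sqrt_pos.2 (by positivity)).ne'
  obtain ⟨k, hk⟩ := Real.Angle.angle_eq_iff_two_pi_dvd_sub.1
    (Real.Angle.cos_sin_inj (mul_left_cancel₀ hroot hX.symm) (mul_left_cancel₀ hroot hY.symm))
  exact ⟨rfl, k, by linarith⟩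

end Polar

section Wedge

variable {E : Type*} [NormedAddCommGroup E] [NormedSpace ℝ E] {f g F G : E → ℝ} {p : E}
  {a b c d : ℝ}

/-- The value of the two-form `df ∧ dg` at the point `p` on the vectors `u`, `v`. -/
def wedge (f g : E → ℝ) (p u v : E) : ℝ :=
  fderiv ℝ f p u * fderiv ℝ g p v - fderiv ℝ g p u * fderiv ℝ f p v

lemma wedge_eq_det_mul (hF : HasFDerivAt F (a • fderiv ℝ f p + b • fderiv ℝ g p) p)
    (hG : HasFDerivAt G (c • fderiv ℝ f p + d • fderiv ℝ g p) p) (u v : E) :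
    wedge F G p u v = (a * d - b * c) * wedge f g p u v := by
  simp only [wedge, hF.fderiv, hG.fderiv, add_apply, smul_apply, smul_eq_mul]
  ring

lemma hasFDerivAt_polarX (hf : DifferentiableAt ℝ f p) (hg : DifferentiableAt ℝ g p)
    (h0 : 0 < f p) :
    HasFDerivAt (fun q => polarX (f q) (g q)) ((cos (g p) / √(2 * f p)) • fderiv ℝ f p +
      (-(√(2 * f p) * sin (g p))) • fderiv ℝ g p) p := by
  refine (((hf.hasFDerivAt.const_mul 2).sqrt (by positivity)).mul
    hg.hasFDerivAt.cos).congr_fderiv ?_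
  module

lemma hasFDerivAt_polarY (hf : DifferentiableAt ℝ f p) (hg : DifferentiableAt ℝ g p)
    (h0 : 0 < f p) :
    HasFDerivAt (fun q => polarY (f q) (g q)) ((sin (g p) / √(2 * f p)) • fderiv ℝ f p +
      (√(2 * f p) * cos (g p)) • fderiv ℝ g p) p := by
  refine (((hf.hasFDerivAt.const_mul 2).sqrt (by positivity)).mul
    hg.hasFDerivAt.sin).congr_fderiv ?_
  module

lemma contDiffAt_polarX (hf : ContDiffAt ℝ ∞ f p) (hg : ContDiffAt ℝ ∞ g p) (h0 : 0 < f p) :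
    ContDiffAt ℝ ∞ (fun q => polarX (f q) (g q)) p :=
  ((contDiffAt_const.mul hf).sqrt (by positivity)).mul hg.cos

lemma contDiffAt_polarY (hf : ContDiffAt ℝ ∞ f p) (hg : ContDiffAt ℝ ∞ g p) (h0 : 0 < f p) :
    ContDiffAt ℝ ∞ (fun q => polarY (f q) (g q)) p :=
  ((contDiffAt_const.mul hf).sqrt (by positivity)).mul hg.sin

lemma wedge_polar (hf : DifferentiableAt ℝ f p) (hg : DifferentiableAt ℝ g p) (h0 : 0 < f p)
    (u v : E) :
    wedge (fun q => polarX (f q) (g q)) (fun q => polarY (f q) (g q)) p u v = wedge f g p u v := by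
  have hroot : √(2 * f p) ≠ 0 := (Real.sqrt_pos.2 (by positivity)).ne'
  rw [wedge_eq_det_mul (hasFDerivAt_polarX hf hg h0) (hasFDerivAt_polarY hf hg h0)]
  field_simp
  linear_combination wedge f g p u v * cos_sq_add_sin_sq (g p)

lemma wedge_slice {ρ : ℝ} (hf : DifferentiableAt ℝ f p) (hg : DifferentiableAt ℝ g p)
    (h : f p ∈ Ioo (-ρ) ρ) (u v : E) :
    wedge (fun q => sliceArea ρ (f q)) (fun q => sliceAngle ρ (f q) (g q)) p u v =
      wedge f g p u v := by
  have hroot : √(ρ ^ 2 - f p ^ 2) ≠ 0 := (Real.sqrt_pos.2 (sq_sub_sq_pos h)).ne'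
  obtain ⟨c, hc⟩ : ∃ c, HasDerivAt (fun x => π / √(ρ ^ 2 - x ^ 2)) c (f p) :=
    ⟨_, ((((hasDerivAt_pow 2 (f p)).const_sub (ρ ^ 2)).sqrt (sq_sub_sq_pos h).ne').fun_inv
      hroot).const_mul π⟩
  have hF : HasFDerivAt (fun q => sliceArea ρ (f q))
      ((√(ρ ^ 2 - f p ^ 2) / π) • fderiv ℝ f p + (0 : ℝ) • fderiv ℝ g p) p := by
    rw [zero_smul, add_zero]
    exact (hasDerivAt_sliceArea ρ (f p)).comp_hasFDerivAt p hf.hasFDerivAt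
  have hG : HasFDerivAt (fun q => sliceAngle ρ (f q) (g q))
      ((g p * c) • fderiv ℝ f p + (π / √(ρ ^ 2 - f p ^ 2)) • fderiv ℝ g p) p := by
    have hG' := ((hc.comp_hasFDerivAt p hf.hasFDerivAt).mul hg.hasFDerivAt).add_const π
    refine (hG'.congr_fderiv ?_).congr_of_eventuallyEq (.of_forall fun q => ?_)
    · simp only [Function.comp_apply]
      module
    · simp only [sliceAngle, Pi.mul_apply, Function.comp_apply]
      ring
  rw [wedge_eq_det_mul hF hG]
  field_simp
  ring

lemma wedge_ellipse {m κ s₀ β Λ : ℝ} (hf : DifferentiableAt ℝ f p) (hg : DifferentiableAt ℝ g p)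
    (h0 : 0 < s₀ + β * g p) (u v : E) :
    wedge (fun q => m + polarY (s₀ + β * g q) (Λ * f q))
      (fun q => κ * polarX (s₀ + β * g q) (Λ * f q)) p u v = κ * Λ * β * wedge f g p u v := by
  have hs : DifferentiableAt ℝ (fun q => s₀ + β * g q) p := (hg.const_mul β).const_add s₀
  have ht : DifferentiableAt ℝ (fun q => Λ * f q) p := hf.const_mul Λ
  have hpolar := wedge_polar hs ht h0 u v
  simp only [wedge, fderiv_const_add, fderiv_const_mul hf, fderiv_const_mul hg,
    fderiv_const_mul (hasFDerivAt_polarX hs ht h0).differentiableAt, smul_apply,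
    smul_eq_mul] at hpolar ⊢
  linear_combination -κ * hpolar

lemma wedge_shear {c d e : ℝ → ℝ} {s₁ t₁ s₂ t₂ x y : E → ℝ} (hc : ContDiff ℝ ∞ c)
    (hd : ContDiff ℝ ∞ d) (he : ContDiff ℝ ∞ e) (hs₁ : DifferentiableAt ℝ s₁ p)
    (ht₁ : DifferentiableAt ℝ t₁ p) (hs₂ : DifferentiableAt ℝ s₂ p)
    (ht₂ : DifferentiableAt ℝ t₂ p) (hx : DifferentiableAt ℝ x p) (hy : DifferentiableAt ℝ y p)
    (u v : E) :
    wedge (fun q => s₁ q + c (s₂ q)) t₁ p u v +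
      wedge s₂ (fun q => t₂ q + (-deriv c (s₂ q) * t₁ q - deriv d (s₂ q) * y q + e (s₂ q))) p u v +
      wedge (fun q => x q + d (s₂ q)) y p u v =
    wedge s₁ t₁ p u v + wedge s₂ t₂ p u v + wedge x y p u v := by
  have hcomp {g : ℝ → ℝ} (hg : ContDiff ℝ ∞ g) :
      HasFDerivAt (fun q => g (s₂ q)) (deriv g (s₂ p) • fderiv ℝ s₂ p) p :=
    (hg.differentiable (by simp) _).hasDerivAt.comp_hasFDerivAt p hs₂.hasFDerivAt
  have hs₁' := (hs₁.hasFDerivAt.fun_add (hcomp hc)).fderiv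
  have hx' := (hx.hasFDerivAt.fun_add (hcomp hd)).fderiv
  have ht₂' := (ht₂.hasFDerivAt.fun_add
    ((((hcomp (contDiff_infty_iff_deriv.1 hc).2).fun_neg.fun_mul ht₁.hasFDerivAt).fun_sub
      ((hcomp (contDiff_infty_iff_deriv.1 hd).2).fun_mul hy.hasFDerivAt)).fun_add
        (hcomp he))).fderiv
  simp only [wedge, hs₁', hx', ht₂', add_apply, sub_apply, neg_apply, smul_apply, smul_eq_mul]
  ring

end Wedge

section SymplecticMaps

variable {a b c d n : ℕ} {φ : R2 a × R2 b → R2 c × R2 d} {U : Set (R2 a × R2 b)} {p : R2 a × R2 b}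

lemma stdForm_single_inr (u : R2 n) (i : Fin n) :
    stdForm u (EuclideanSpace.single (Sum.inr i) 1) = u (Sum.inl i) := by
  simp [stdForm]

lemma stdForm_single_inl (u : R2 n) (i : Fin n) :
    stdForm u (EuclideanSpace.single (Sum.inl i) 1) = -u (Sum.inr i) := by
  simp [stdForm]

lemma stdForm_zero_left (v : R2 n) : stdForm 0 v = 0 := by simp [stdForm]

lemma stdForm_zero_right (u : R2 n) : stdForm u 0 = 0 := by simp [stdForm]

lemma eq_zero_of_stdForm_eq_zero {u : R2 n} (h : ∀ v, stdForm u v = 0) : u = 0 := by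
  ext (i | i)
  · simpa only [stdForm_single_inr, PiLp.zero_apply] using h (EuclideanSpace.single (Sum.inr i) 1)
  · simpa only [stdForm_single_inl, neg_eq_zero, PiLp.zero_apply] using
      h (EuclideanSpace.single (Sum.inl i) 1)

lemma eq_zero_of_prodForm_eq_zero {u : R2 a × R2 b} (h : ∀ v, prodForm u v = 0) : u = 0 :=
  Prod.ext
    (eq_zero_of_stdForm_eq_zero fun v => by
      simpa only [prodForm, stdForm_zero_right, add_zero] using h (v, 0))
    (eq_zero_of_stdForm_eq_zero fun v => by
      simpa only [prodForm, stdForm_zero_right, zero_add] using h (0, v))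

lemma injective_of_prodForm_eq {L : R2 a × R2 b →L[ℝ] R2 c × R2 d}
    (hL : ∀ u v, prodForm (L u) (L v) = prodForm u v) : Function.Injective L := by
  refine (injective_iff_map_eq_zero L).2 fun u hu => eq_zero_of_prodForm_eq_zero fun v => ?_
  rw [← hL, hu, prodForm, Prod.fst_zero, Prod.snd_zero, stdForm_zero_left, stdForm_zero_left,
    add_zero]

lemma map_nhds_eq_of_prodForm_fderiv_eq (hdim : a + b = c + d) (hφ : ContDiffAt ℝ ∞ φ p)
    (hω : ∀ u v, prodForm (fderiv ℝ φ p u) (fderiv ℝ φ p v) = prodForm u v) :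
    map φ (𝓝 p) = 𝓝 (φ p) := by
  have hrank : Module.finrank ℝ (R2 a × R2 b) = Module.finrank ℝ (R2 c × R2 d) := by
    simp only [Module.finrank_prod, finrank_euclideanSpace, Fintype.card_sum, Fintype.card_fin]
    omega
  have hsurj := (LinearMap.injective_iff_surjective_of_finrank_eq_finrank
    (f := (fderiv ℝ φ p).toLinearMap) hrank).1 (injective_of_prodForm_eq hω)
  exact (hφ.hasStrictFDerivAt (by simp)).map_nhds_eq_of_surj (LinearMap.range_eq_top.2 hsurj)

lemma isSymplecticEmbeddingOn_of_injOn (hdim : a + b = c + d) (hU : IsOpen U)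
    (hφ : ∀ p ∈ U, ContDiffAt ℝ ∞ φ p)
    (hω : ∀ p ∈ U, ∀ u v, prodForm (fderiv ℝ φ p u) (fderiv ℝ φ p v) = prodForm u v)
    (hinj : InjOn φ U) : IsSymplecticEmbeddingOn φ U where
  isOpen := hU
  contDiffOn p hp := (hφ p hp).contDiffWithinAt
  pullback_eq := hω
  isEmbedding := by
    have hopen : IsOpenMap (U.domRestrict φ) := isOpenMap_iff_nhds_le.2 fun p => by
      rw [show U.domRestrict φ = φ ∘ Subtype.val from rfl, ← Filter.map_map,
        map_nhds_subtype_coe_eq_nhds p.2 (hU.mem_nhds p.2),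
        map_nhds_eq_of_prodForm_fderiv_eq hdim (hφ p p.2) (hω p p.2)]
      rfl
    have hcont : ContinuousOn φ U := fun p hp => (hφ p hp).continuousAt.continuousWithinAt
    exact (IsOpenEmbedding.of_continuous_injective_isOpenMap
      (continuousOn_iff_continuous_domRestrict.1 hcont) (injOn_iff_injective.1 hinj)
      hopen).isEmbedding

lemma stdForm_fderiv {E : Type*} [NormedAddCommGroup E] [NormedSpace ℝ E] {F : E → R2 n} {p : E}
    (hF : DifferentiableAt ℝ F p) (u v : E) :
    stdForm (fderiv ℝ F p u) (fderiv ℝ F p v) =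
      ∑ i, wedge (fun q => F q (Sum.inl i)) (fun q => F q (Sum.inr i)) p u v := by
  have hcoord (i) (w : E) : fderiv ℝ F p w i = fderiv ℝ (fun q => F q i) p w := by
    rw [HasFDerivAt.fderiv (f := fun q => F q i)
      ((EuclideanSpace.proj (𝕜 := ℝ) i).hasFDerivAt.comp p hF.hasFDerivAt)]
    rfl
  simp only [stdForm, wedge, hcoord]

lemma prodForm_fderiv (hφ : DifferentiableAt ℝ φ p) (u v : R2 a × R2 b) :
    prodForm (fderiv ℝ φ p u) (fderiv ℝ φ p v) =
      (∑ i, wedge (fun q => (φ q).1 (Sum.inl i)) (fun q => (φ q).1 (Sum.inr i)) p u v) +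
      ∑ i, wedge (fun q => (φ q).2 (Sum.inl i)) (fun q => (φ q).2 (Sum.inr i)) p u v := by
  rw [← stdForm_fderiv hφ.fst, ← stdForm_fderiv hφ.snd, fderiv.fst hφ, fderiv.snd hφ]
  rfl

lemma prodForm_eq_sum_wedge (p u v : R2 a × R2 b) :
    prodForm u v =
      (∑ i, wedge (fun q : R2 a × R2 b => q.1 (Sum.inl i)) (fun q => q.1 (Sum.inr i)) p u v) +
      ∑ i, wedge (fun q : R2 a × R2 b => q.2 (Sum.inl i)) (fun q => q.2 (Sum.inr i)) p u v := by
  simpa only [fderiv_fun_id, ContinuousLinearMap.id_apply] using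
    prodForm_fderiv (φ := fun q : R2 a × R2 b => q) (p := p) differentiableAt_id u v

end SymplecticMaps

section Turns

variable {X X₀ : ℝ} {j : ℤ}

/-- The number of the turn to which the angle `X` belongs, the `j`-th turn being
`[2 * π * j - π / 2, 2 * π * (j + 1) - π / 2)`. -/
def turnIndex (X : ℝ) : ℤ := toIcoDiv two_pi_pos (-(π / 2)) X

lemma turnIndex_add_int_mul_two_pi (X : ℝ) (j : ℤ) :
    turnIndex (X + j * (2 * π)) = turnIndex X + j := by
  simpa only [turnIndex, zsmul_eq_mul] using toIcoDiv_add_zsmul two_pi_pos (-(π / 2)) X j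

lemma turnIndex_eq (h : X - j * (2 * π) ∈ Ico (-(π / 2)) (3 * π / 2)) : turnIndex X = j := by
  refine toIcoDiv_eq_of_sub_zsmul_mem_Ico two_pi_pos ?_
  rw [zsmul_eq_mul]
  exact ⟨h.1, h.2.trans_eq (by ring)⟩

lemma turnIndex_eventuallyEq (h : sin X₀ ≠ -1) : turnIndex =ᶠ[𝓝 X₀] fun _ => turnIndex X₀ := by
  refine eventuallyEq_toIcoDiv_nhds two_pi_pos _ fun hmod => h ?_
  obtain ⟨k, rfl⟩ := AddCommGroup.modEq_iff_eq_add_zsmul.1 hmod.symm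
  exact Real.sin_eq_neg_one_iff.2 ⟨k, by rw [zsmul_eq_mul]⟩

lemma exists_eventually_turnIndex (h : sin X₀ = -1) :
    ∃ j, ∀ᶠ X in 𝓝 X₀, cos X < 0 ∧ turnIndex X = j - 1 ∨ ¬cos X < 0 ∧ turnIndex X = j := by
  obtain ⟨j, rfl⟩ := Real.sin_eq_neg_one_iff.1 h
  refine ⟨j, ?_⟩
  filter_upwards [Ioo_mem_nhds (sub_lt_self _ pi_pos) (lt_add_of_pos_right _ pi_pos)] with X hX
  have hcos : cos X = cos (X - j * (2 * π)) := (cos_sub_int_mul_two_pi X j).symm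
  rcases lt_or_ge X (-(π / 2) + j * (2 * π)) with hlt | hge
  · refine .inl ⟨?_, turnIndex_eq ?_⟩
    · rw [hcos, ← cos_neg]
      exact cos_neg_of_pi_div_two_lt_of_lt (by linarith) (by linarith [hX.1])
    · push_cast
      constructor <;> linarith [hX.1, pi_pos]
  · refine .inr ⟨not_lt.2 ?_, turnIndex_eq ?_⟩
    · rw [hcos]
      exact cos_nonneg_of_mem_Icc ⟨by linarith, by linarith [hX.2]⟩
    · constructor <;> linarith [hX.2, pi_pos]
lemma eq_zero_of_abs_int_mul_lt {k : ℤ} {a : ℝ} (h : |k * a| < a) : k = 0 := by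
  have ha : 0 < a := (abs_nonneg _).trans_lt h
  rw [abs_mul, abs_of_pos ha, mul_lt_iff_lt_one_left ha] at h
  exact Int.abs_lt_one_iff.1 (by exact_mod_cast h)

end Turns

/-- The coefficients of the Hamiltonian `c (s₂) * t₁ + d (s₂) * y - ∫ e (s₂)`, whose time-one map
adds `c (s₂)` to `s₁`, adds `d (s₂)` to `x`, and adds `rotation` to `t₂`. -/
structure Shear where
  (c d e : ℝ → ℝ)
  contDiff_c : ContDiff ℝ ∞ c
  contDiff_d : ContDiff ℝ ∞ d
  contDiff_e : ContDiff ℝ ∞ e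
  c_nonneg : ∀ s, 0 ≤ c s

namespace Shear

/-- The displacement of the coordinate `t₂` under a shear. -/
def rotation (σ : Shear) (t₁ s₂ y : ℝ) : ℝ :=
  -deriv σ.c s₂ * t₁ - deriv σ.d s₂ * y + σ.e s₂

/-- Two shears have the same coefficients near `s`. -/
structure EqAt (σ τ : Shear) (s : ℝ) : Prop where
  c : σ.c =ᶠ[𝓝 s] τ.c
  d : σ.d =ᶠ[𝓝 s] τ.d
  e : σ.e =ᶠ[𝓝 s] τ.e

lemma EqAt.refl (σ : Shear) (s : ℝ) : σ.EqAt σ s := ⟨.rfl, .rfl, .rfl⟩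

end Shear

/-- The parameters of the wrapping construction: `ρ` is the radius of the disc, the strip is wound
around ellipses which meet the axis of the action `s₂` in points of `(0, h)` and of
`(2 * (h + L), 3 * h + 2 * L)`, the function `up - down` lifts the disc by its whole area above the
middle interval `[h + L, 2 * h + L]`, and `sep` separates the turns above that interval. -/
structure WrappingData (R T : ℝ) where
  (ρ L h θ : ℝ)
  (up down sep : ℝ → ℝ)
  T_pos : 0 < T
  one_lt_ρ : 1 < ρ
  L_pos : 0 < L
  h_pos : 0 < h
  θ_lt_one : θ < 1
  up_step : IsSmoothStep up h (h + L) (ρ ^ 2 / 2)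
  down_step : IsSmoothStep down (2 * h + L) (2 * (h + L)) (ρ ^ 2 / 2)
  sep_step : IsSmoothStep sep (h + L) (2 * h + L) (2 * T)
  deriv_up_mem : ∀ s, deriv up s ∈ Icc 0 θ
  deriv_down_mem : ∀ s, deriv down s ∈ Icc 0 θ
  room : ρ ^ 2 / 2 + (3 * h + 2 * L) ≤ R ^ 2 / 2

-- The lift costs `ρ ^ 2 / 2 > 1 / 2` on each side of the ellipse with slope less than `1`, so that
-- the ellipse has width `2 * L > 1`; with the disc itself this needs `R ^ 2 / 2 > 3 / 2`.
lemma exists_wrappingData {R T : ℝ} (hR : √3 < R) (hT : 0 < T) : Nonempty (WrappingData R T) := by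
  have hR2 : 3 < R ^ 2 := (Real.sqrt_lt' ((Real.sqrt_nonneg 3).trans_lt hR)).1 hR
  obtain ⟨ε, hε⟩ : ∃ ε, ε = (R ^ 2 - 3) / 16 := ⟨_, rfl⟩
  have hε0 : 0 < ε := by linarith
  have hρ : √(1 + 2 * ε) ^ 2 / 2 = 1 / 2 + ε := by rw [Real.sq_sqrt (by linarith)]; ring
  obtain ⟨θ, hθ, hθ1⟩ := exists_between (show (1 / 2 + ε) / (1 / 2 + 2 * ε) < 1 by
    rw [div_lt_one (by linarith)]; linarith)
  rw [div_lt_iff₀ (by linarith)] at hθ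
  obtain ⟨up, hup, hup'⟩ := exists_isSmoothStep_deriv_mem_Icc
    (a := ε) (b := ε + (1 / 2 + 2 * ε)) (θ := θ) (α := 1 / 2 + ε)
    (by linarith) (by linarith) (by rwa [add_sub_cancel_left])
  obtain ⟨down, hdown, hdown'⟩ := exists_isSmoothStep_deriv_mem_Icc
    (a := 2 * ε + (1 / 2 + 2 * ε)) (b := 2 * (ε + (1 / 2 + 2 * ε))) (θ := θ) (α := 1 / 2 + ε)
    (by linarith) (by linarith) (by linarith)
  exact ⟨{
    ρ := √(1 + 2 * ε), L := 1 / 2 + 2 * ε, h := ε, θ := θ, up := up, down := down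
    sep := _
    T_pos := hT
    one_lt_ρ := by rw [Real.lt_sqrt zero_le_one]; linarith
    L_pos := by linarith
    h_pos := hε0
    θ_lt_one := hθ1
    up_step := hρ ▸ hup
    down_step := hρ ▸ hdown
    sep_step := isSmoothStep_smoothTransition (by linarith) (2 * T)
    deriv_up_mem := hup'
    deriv_down_mem := hdown'
    room := by rw [hρ]; linarith }⟩

namespace WrappingData

variable {R T : ℝ} (D : WrappingData R T) {s t : ℝ}

lemma ρ_pos : 0 < D.ρ := one_pos.trans D.one_lt_ρ

lemma θ_nonneg : 0 ≤ D.θ := (D.deriv_up_mem 0).1.trans (D.deriv_up_mem 0).2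

/-- The action coordinate of the centre of the ellipses. -/
def m : ℝ := D.L + 3 * D.h / 2

lemma h_lt_m : D.h < D.m := by
  rw [m]
  linarith [D.L_pos, D.h_pos]

lemma m_pos : 0 < D.m := D.h_pos.trans D.h_lt_m

/-- The ratio of the half-axes of the ellipses. -/
def κ : ℝ := π * (1 - D.θ) / D.m

lemma κ_pos : 0 < D.κ := div_pos (mul_pos pi_pos (sub_pos.2 D.θ_lt_one)) D.m_pos

lemma κ_mul_m : D.κ * D.m = π * (1 - D.θ) := div_mul_cancel₀ _ D.m_pos.ne'

/-- The displacement of the first factor on the front of the ellipses. -/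
def lift (s : ℝ) : ℝ := D.up s - D.down s

lemma contDiff_lift : ContDiff ℝ ∞ D.lift := D.up_step.contDiff.sub D.down_step.contDiff

lemma deriv_lift (s : ℝ) : deriv D.lift s = deriv D.up s - deriv D.down s :=
  deriv_fun_sub (D.up_step.differentiable s) (D.down_step.differentiable s)

lemma lift_nonneg (s : ℝ) : 0 ≤ D.lift s := by
  have hup := D.up_step.mem_Icc
    (monotone_of_deriv_nonneg D.up_step.differentiable fun s => (D.deriv_up_mem s).1) s
  have hdown := D.down_step.mem_Icc
    (monotone_of_deriv_nonneg D.down_step.differentiable fun s => (D.deriv_down_mem s).1) s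
  rw [lift, sub_nonneg]
  rcases le_total s (2 * D.h + D.L) with hs | hs
  · rw [D.down_step.eq_zero_of_le s hs]
    exact hup.1
  · rw [D.up_step.eq_of_ge s (by linarith [D.h_pos])]
    exact hdown.2

lemma lift_eq_of_deriv_sep_ne_zero (hs : deriv D.sep s ≠ 0) : D.lift s = D.ρ ^ 2 / 2 := by
  have hmem := D.sep_step.mem_Icc_of_deriv_ne_zero hs
  rw [lift, D.up_step.eq_of_ge s hmem.1, D.down_step.eq_zero_of_le s hmem.2, sub_zero]

lemma lift_eventuallyEq_zero_of_lt (hs : s < D.h) : D.lift =ᶠ[𝓝 s] 0 := by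
  have hdown := D.down_step.eventuallyEq_zero (s := s) (by linarith [D.h_pos, D.L_pos])
  exact ((D.up_step.eventuallyEq_zero hs).sub hdown).trans (.of_eq (by ext; simp))

lemma lift_eventuallyEq_zero_of_gt (hs : 2 * D.m - D.h < s) : D.lift =ᶠ[𝓝 s] 0 := by
  rw [m] at hs
  have hup := D.up_step.eventuallyEq_const (s := s) (by linarith [D.h_pos, D.L_pos])
  have hdown := D.down_step.eventuallyEq_const (s := s) (by linarith)
  exact (hup.sub hdown).trans (.of_eq (by ext; simp))

lemma monotone_add_lift : Monotone fun s => s + D.lift s := by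
  have hlift := D.contDiff_lift.differentiable (by simp)
  refine monotone_of_deriv_nonneg (differentiable_id.add hlift) fun s => ?_
  rw [deriv_fun_add differentiableAt_fun_id (hlift s), deriv_lift, deriv_id'']
  linarith [(D.deriv_up_mem s).1, (D.deriv_down_mem s).2, D.θ_lt_one]

lemma add_lift_le (hs : s ≤ 2 * D.m) : D.ρ ^ 2 / 2 + (s + D.lift s) ≤ R ^ 2 / 2 := by
  have hmono : s + D.lift s ≤ 2 * D.m + D.lift (2 * D.m) := D.monotone_add_lift hs
  rw [(D.lift_eventuallyEq_zero_of_gt (sub_lt_self _ D.h_pos)).eq_of_nhds, Pi.zero_apply, m]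
    at hmono
  linarith [D.room]

/-- The shear applied on the front of the ellipses during the `j`-th turn. -/
def front (j : ℤ) : Shear where
  c := D.lift
  d _ := 2 * T * j
  e s := 2 * π * deriv D.up s
  contDiff_c := D.contDiff_lift
  contDiff_d := contDiff_const
  contDiff_e := contDiff_const.mul D.up_step.contDiff_deriv
  c_nonneg := D.lift_nonneg

/-- The shear applied on the back of the ellipses during the `j`-th turn. -/
def back (j : ℤ) : Shear where
  c _ := 0
  d s := 2 * T * (j + 1) - D.sep s
  e _ := 0
  contDiff_c := contDiff_const
  contDiff_d := contDiff_const.sub D.sep_step.contDiff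
  contDiff_e := contDiff_const
  c_nonneg _ := le_rfl

lemma front_rotation_mem (j : ℤ) (ht : t ∈ Ioo 0 (2 * π)) (s y : ℝ) :
    (D.front j).rotation t s y ∈ Icc 0 (2 * π * D.θ) := by
  have heq : (D.front j).rotation t s y = deriv D.up s * (2 * π - t) + deriv D.down s * t := by
    simp only [Shear.rotation, front, deriv_lift, deriv_const]
    ring
  have hup := D.deriv_up_mem s
  have hdown := D.deriv_down_mem s
  have ht' : 0 < 2 * π - t := sub_pos.2 ht.2
  rw [heq]
  exact ⟨add_nonneg (mul_nonneg hup.1 ht'.le) (mul_nonneg hdown.1 ht.1.le),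
    by nlinarith [mul_le_mul_of_nonneg_right hup.2 ht'.le,
      mul_le_mul_of_nonneg_right hdown.2 ht.1.le]⟩

lemma back_rotation (j : ℤ) (t s y : ℝ) : (D.back j).rotation t s y = deriv D.sep s * y := by
  simp [Shear.rotation, back]

lemma back_eqAt_front_of_lt (j : ℤ) (hs : s < D.h) : (D.back (j - 1)).EqAt (D.front j) s where
  c := (D.lift_eventuallyEq_zero_of_lt hs).symm
  d := by
    filter_upwards [D.sep_step.eventuallyEq_zero (by linarith [D.L_pos] : s < D.h + D.L)]
      with x hx
    simp [back, front, hx]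
  e := by
    filter_upwards [D.up_step.deriv_eventuallyEq_zero hs] with x hx
    simp [back, front, hx]

lemma back_eqAt_front_of_gt (j : ℤ) (hs : 2 * D.m - D.h < s) :
    (D.back j).EqAt (D.front j) s where
  c := (D.lift_eventuallyEq_zero_of_gt hs).symm
  d := by
    rw [m] at hs
    filter_upwards [D.sep_step.eventuallyEq_const (by linarith [D.L_pos] : 2 * D.h + D.L < s)]
      with x hx
    simp only [back, front, hx]
    ring
  e := by
    rw [m] at hs
    filter_upwards [D.up_step.deriv_eventuallyEq_zero_of_gt
      (by linarith [D.L_pos, D.h_pos] : D.h + D.L < s)] with x hx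
    simp [back, front, hx]

/-- The shear applied at the angle `X` of the ellipses. -/
def shear (X : ℝ) : Shear := if cos X < 0 then D.back (turnIndex X) else D.front (turnIndex X)

lemma shear_eventuallyEq {X₀ : ℝ} (h : cos X₀ ≠ 0) : D.shear =ᶠ[𝓝 X₀] fun _ => D.shear X₀ := by
  have hsin : sin X₀ ≠ -1 := fun hsin => h (by
    simpa [hsin] using sin_sq_add_cos_sq X₀)
  have hcos : ∀ᶠ X in 𝓝 X₀, (cos X < 0 ↔ cos X₀ < 0) := by
    rcases h.lt_or_gt with hneg | hpos
    · filter_upwards [continuous_cos.continuousAt.eventually (Iio_mem_nhds hneg)] with X hX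
      exact iff_of_true hX hneg
    · filter_upwards [continuous_cos.continuousAt.eventually (Ioi_mem_nhds hpos)] with X hX
      exact iff_of_false (not_lt.2 (le_of_lt hX)) hpos.not_gt
  filter_upwards [turnIndex_eventuallyEq hsin, hcos] with X hturn hside
  simp only [shear, hturn, hside]

lemma exists_shear_eqAt {X₀ s₀ : ℝ} (hbottom : sin X₀ = -1 → s₀ < D.h)
    (htop : sin X₀ = 1 → 2 * D.m - D.h < s₀) :
    ∃ σ, ∀ᶠ z : ℝ × ℝ in 𝓝 X₀ ×ˢ 𝓝 s₀, (D.shear z.1).EqAt σ z.2 := by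
  by_cases hcos : cos X₀ = 0
  · have hsin : sin X₀ = 1 ∨ sin X₀ = -1 := by
      simpa [hcos] using sin_sq_add_cos_sq X₀
    rcases hsin with hsin | hsin
    · refine ⟨D.front (turnIndex X₀), ?_⟩
      filter_upwards [(turnIndex_eventuallyEq (by rw [hsin]; norm_num)).prod_mk
        (Ioi_mem_nhds (htop hsin))] with z hz
      rw [shear, hz.1]
      split_ifs
      exacts [D.back_eqAt_front_of_gt _ hz.2, .refl _ _]
    · obtain ⟨j, hj⟩ := exists_eventually_turnIndex hsin
      refine ⟨D.front j, ?_⟩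
      filter_upwards [hj.prod_mk (Iio_mem_nhds (hbottom hsin))] with z ⟨hz, hs⟩
      rcases hz with ⟨hneg, hturn⟩ | ⟨hnonneg, hturn⟩
      · rw [shear, if_pos hneg, hturn]
        exact D.back_eqAt_front_of_lt j hs
      · rw [shear, if_neg hnonneg, hturn]
        exact .refl _ _
  · refine ⟨D.shear X₀, ?_⟩
    filter_upwards [(D.shear_eventuallyEq hcos).prod_inl (𝓝 s₀)] with z hz
    rw [hz]
    exact .refl _ _

variable {N : ℕ} {p q : R2 1 × R2 (N + 2)} {σ τ : Shear}

/-- The open neighbourhood of a product of closed balls on which the wrapping map is defined. -/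
def domain (N : ℕ) : Set (R2 1 × R2 (N + 2)) := Metric.ball 0 D.ρ ×ˢ Metric.ball 0 T

/-- The action coordinate in the disc. -/
def s₁ (p : R2 1 × R2 (N + 2)) : ℝ := sliceArea D.ρ (p.1 (Sum.inl 0))

/-- The angle coordinate in the disc. -/
def t₁ (p : R2 1 × R2 (N + 2)) : ℝ := sliceAngle D.ρ (p.1 (Sum.inl 0)) (p.1 (Sum.inr 0))

/-- The increase of the action of the ellipses per unit length across the strip; it is chosen such
that the strip of width `2 * T` covers the actions between `(m - h) ^ 2 / 2` and `m ^ 2 / 2`. -/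
def β : ℝ := (D.m ^ 2 - (D.m - D.h) ^ 2) / (4 * T)

/-- The angle on the ellipses at which a point of the strip is placed. It is a real number and
not just an angle: the strip covers its ellipses many times. The factor makes the map area
preserving. -/
def angle (p : R2 1 × R2 (N + 2)) : ℝ := (D.κ * D.β)⁻¹ * p.2 (Sum.inl 0)

/-- The action of the ellipse on which a point of the strip is placed. -/
def bandAction (p : R2 1 × R2 (N + 2)) : ℝ :=
  (D.m ^ 2 + (D.m - D.h) ^ 2) / 4 + D.β * p.2 (Sum.inr 0)

/-- The action coordinate in the plane of the ellipses. -/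
def s₂ (p : R2 1 × R2 (N + 2)) : ℝ := D.m + polarY (D.bandAction p) (D.angle p)

/-- The angle coordinate in the plane of the ellipses, before the shear. -/
def t₂ (p : R2 1 × R2 (N + 2)) : ℝ := D.κ * polarX (D.bandAction p) (D.angle p)

lemma β_pos : 0 < D.β :=
  div_pos (by nlinarith [D.h_pos, D.h_lt_m]) (by linarith [D.T_pos])

variable {D}

lemma sq_add_sq_lt (hp : p ∈ D.domain N) :
    p.1 (Sum.inl 0) ^ 2 + p.1 (Sum.inr 0) ^ 2 < D.ρ ^ 2 := by
  have h := pow_lt_pow_left₀ (mem_ball_zero_iff.1 hp.1) (norm_nonneg _) two_ne_zero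
  simpa [EuclideanSpace.norm_sq_eq] using h

lemma abs_snd_lt (hp : p ∈ D.domain N) (i : Fin (N + 2) ⊕ Fin (N + 2)) : |p.2 i| < T :=
  (PiLp.norm_apply_le p.2 i).trans_lt (mem_ball_zero_iff.1 hp.2)

lemma fst_inl_mem_Ioo (hp : p ∈ D.domain N) : p.1 (Sum.inl 0) ∈ Ioo (-D.ρ) D.ρ :=
  abs_lt.1 (abs_lt_of_sq_lt_sq
    (by linarith [sq_add_sq_lt hp, sq_nonneg (p.1 (Sum.inr 0))]) D.ρ_pos.le)

lemma s₁_mem_Ioo (hp : p ∈ D.domain N) : D.s₁ p ∈ Ioo 0 (D.ρ ^ 2 / 2) :=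
  sliceArea_mem_Ioo (fst_inl_mem_Ioo hp)

lemma t₁_mem_Ioo (hp : p ∈ D.domain N) : D.t₁ p ∈ Ioo 0 (2 * π) :=
  sliceAngle_mem_Ioo (sq_add_sq_lt hp)

lemma two_mul_bandAction_mem_Ioo (hp : p ∈ D.domain N) :
    2 * D.bandAction p ∈ Ioo ((D.m - D.h) ^ 2) (D.m ^ 2) := by
  have hy := abs_lt.1 (abs_snd_lt hp (Sum.inr 0))
  have hT : D.β * T = (D.m ^ 2 - (D.m - D.h) ^ 2) / 4 := by
    have := D.T_pos.ne'
    rw [β]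
    field_simp
  have hlower := mul_lt_mul_of_pos_left hy.1 D.β_pos
  have hupper := mul_lt_mul_of_pos_left hy.2 D.β_pos
  rw [bandAction]
  constructor <;> linarith

lemma bandAction_pos (hp : p ∈ D.domain N) : 0 < D.bandAction p := by
  linarith [sq_nonneg (D.m - D.h), (two_mul_bandAction_mem_Ioo hp).1]

lemma sqrt_bandAction_mem_Ioo (hp : p ∈ D.domain N) :
    √(2 * D.bandAction p) ∈ Ioo (D.m - D.h) D.m :=
  ⟨Real.lt_sqrt_of_sq_lt (two_mul_bandAction_mem_Ioo hp).1,
    (Real.sqrt_lt' D.m_pos).2 (two_mul_bandAction_mem_Ioo hp).2⟩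

lemma s₂_mem_Ioo (hp : p ∈ D.domain N) : D.s₂ p ∈ Ioo 0 (2 * D.m) := by
  have hsq := polarX_sq_add_polarY_sq (bandAction_pos hp).le (D.angle p)
  have hsq_lt : polarY (D.bandAction p) (D.angle p) ^ 2 < D.m ^ 2 := by
    linarith [(two_mul_bandAction_mem_Ioo hp).2,
      sq_nonneg (polarX (D.bandAction p) (D.angle p))]
  have habs := abs_lt.1 (abs_lt_of_sq_lt_sq hsq_lt D.m_pos.le)
  rw [s₂]
  constructor <;> linarith

lemma abs_t₂_lt (hp : p ∈ D.domain N) : |D.t₂ p| < π * (1 - D.θ) := by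
  have hsq := polarX_sq_add_polarY_sq (bandAction_pos hp).le (D.angle p)
  have hsq_lt : polarX (D.bandAction p) (D.angle p) ^ 2 < D.m ^ 2 := by
    linarith [(two_mul_bandAction_mem_Ioo hp).2,
      sq_nonneg (polarY (D.bandAction p) (D.angle p))]
  rw [← D.κ_mul_m, t₂, abs_mul, abs_of_pos D.κ_pos]
  exact mul_lt_mul_of_pos_left (abs_lt_of_sq_lt_sq hsq_lt D.m_pos.le) D.κ_pos

lemma t₂_nonneg_iff (hp : p ∈ D.domain N) : 0 ≤ D.t₂ p ↔ 0 ≤ cos (D.angle p) := by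
  rw [t₂, mul_nonneg_iff_of_pos_left D.κ_pos, polarX,
    mul_nonneg_iff_of_pos_left (Real.sqrt_pos.2 (mul_pos two_pos (bandAction_pos hp)))]

lemma s₂_lt_of_sin_eq (hp : p ∈ D.domain N) (h : sin (D.angle p) = -1) : D.s₂ p < D.h := by
  rw [s₂, polarY, h]
  linarith [(sqrt_bandAction_mem_Ioo hp).1]

lemma lt_s₂_of_sin_eq (hp : p ∈ D.domain N) (h : sin (D.angle p) = 1) :
    2 * D.m - D.h < D.s₂ p := by
  rw [s₂, polarY, h]
  linarith [(sqrt_bandAction_mem_Ioo hp).1]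

lemma contDiffAt_s₁ (hp : p ∈ D.domain N) : ContDiffAt ℝ ∞ D.s₁ p := by
  have h := (contDiffOn_sliceArea D.ρ).contDiffAt (isOpen_Ioo.mem_nhds (fst_inl_mem_Ioo hp))
  exact h.comp p (f := fun q : R2 1 × R2 (N + 2) => q.1 (Sum.inl 0)) (by fun_prop)

lemma contDiffAt_t₁ (hp : p ∈ D.domain N) : ContDiffAt ℝ ∞ D.t₁ p := by
  have hpos := sq_sub_sq_pos (fst_inl_mem_Ioo hp)
  exact ((by fun_prop : ContDiffAt ℝ ∞ (fun q : R2 1 × R2 (N + 2) => π * q.1 (Sum.inr 0)) p).div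
    (ContDiffAt.sqrt (by fun_prop) hpos.ne') (Real.sqrt_pos.2 hpos).ne').add contDiffAt_const

variable (D) in
lemma contDiff_angle : ContDiff ℝ ∞ (D.angle (N := N)) := by
  unfold angle
  fun_prop

variable (D) in
lemma contDiff_bandAction : ContDiff ℝ ∞ (D.bandAction (N := N)) := by
  unfold bandAction
  fun_prop

lemma contDiffAt_s₂ (hp : p ∈ D.domain N) : ContDiffAt ℝ ∞ D.s₂ p :=
  contDiffAt_const.add (contDiffAt_polarY D.contDiff_bandAction.contDiffAt
    D.contDiff_angle.contDiffAt (bandAction_pos hp))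

lemma contDiffAt_t₂ (hp : p ∈ D.domain N) : ContDiffAt ℝ ∞ D.t₂ p :=
  contDiffAt_const.mul (contDiffAt_polarX D.contDiff_bandAction.contDiffAt
    D.contDiff_angle.contDiffAt (bandAction_pos hp))

lemma wedge_s₁_t₁ (hp : p ∈ D.domain N) (u v : R2 1 × R2 (N + 2)) :
    wedge D.s₁ D.t₁ p u v =
      wedge (fun q : R2 1 × R2 (N + 2) => q.1 (Sum.inl 0)) (fun q => q.1 (Sum.inr 0)) p u v :=
  wedge_slice (f := fun q : R2 1 × R2 (N + 2) => q.1 (Sum.inl 0))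
    (g := fun q => q.1 (Sum.inr 0)) (by fun_prop) (by fun_prop) (fst_inl_mem_Ioo hp) u v

lemma wedge_s₂_t₂ (hp : p ∈ D.domain N) (u v : R2 1 × R2 (N + 2)) :
    wedge D.s₂ D.t₂ p u v =
      wedge (fun q : R2 1 × R2 (N + 2) => q.2 (Sum.inl 0)) (fun q => q.2 (Sum.inr 0)) p u v := by
  have hunit : D.κ * (D.κ * D.β)⁻¹ * D.β = 1 := by
    field_simp [D.κ_pos.ne', D.β_pos.ne']
  have hwedge := wedge_ellipse (m := D.m) (κ := D.κ) (Λ := (D.κ * D.β)⁻¹)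
    (f := fun q : R2 1 × R2 (N + 2) => q.2 (Sum.inl 0)) (g := fun q => q.2 (Sum.inr 0))
    (by fun_prop) (by fun_prop) (bandAction_pos hp) u v
  rwa [hunit, one_mul] at hwedge

lemma eq_of_coordinates_eq (hp : p ∈ D.domain N) (hq : q ∈ D.domain N) (hs₁ : D.s₁ p = D.s₁ q)
    (ht₁ : D.t₁ p = D.t₁ q) (hs₂ : D.s₂ p = D.s₂ q) (ht₂ : D.t₂ p = D.t₂ q)
    (hturn : turnIndex (D.angle p) = turnIndex (D.angle q))
    (hx : ∀ i : Fin (N + 1), p.2 (Sum.inl i.succ) = q.2 (Sum.inl i.succ))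
    (hy : ∀ i : Fin (N + 1), p.2 (Sum.inr i.succ) = q.2 (Sum.inr i.succ)) : p = q := by
  obtain ⟨hx₁, hy₁⟩ := slice_injective (fst_inl_mem_Ioo hp) (fst_inl_mem_Ioo hq) hs₁ ht₁
  obtain ⟨haction, k, hk⟩ := polar_injective (bandAction_pos hp) (bandAction_pos hq)
    (mul_left_cancel₀ D.κ_pos.ne' ht₂) (add_left_cancel hs₂)
  have hk0 : k = 0 := by
    rw [hk, turnIndex_add_int_mul_two_pi] at hturn
    linarith
  rw [hk0, Int.cast_zero, zero_mul, add_zero] at hk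
  have hx₂ : p.2 (Sum.inl 0) = q.2 (Sum.inl 0) :=
    mul_left_cancel₀ (inv_ne_zero (mul_pos D.κ_pos D.β_pos).ne') hk.symm
  have hy₂ : p.2 (Sum.inr 0) = q.2 (Sum.inr 0) :=
    mul_left_cancel₀ D.β_pos.ne' (add_left_cancel haction)
  refine Prod.ext (PiLp.ext ?_) (PiLp.ext ?_)
  · rintro (i | i) <;> rw [Fin.fin_one_eq_zero i]
    exacts [hx₁, hy₁]
  · rintro (i | i) <;> cases i using Fin.cases
    exacts [hx₂, hx _, hy₂, hy _]

variable (D)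

/-- The map which places the disc and the strip in the plane of the ellipses by means of their
action-angle coordinates, sheared by `σ`. -/
def wrapWith (σ : Shear) (p : R2 1 × R2 (N + 2)) : R2 2 × R2 (N + 1) :=
  let S₁ := D.s₁ p + σ.c (D.s₂ p)
  let t₂' := D.t₂ p + σ.rotation (D.t₁ p) (D.s₂ p) (p.2 (Sum.inr 1))
  (WithLp.toLp 2 (Sum.elim ![polarX S₁ (D.t₁ p), polarX (D.s₂ p) t₂']
      ![polarY S₁ (D.t₁ p), polarY (D.s₂ p) t₂']),
    WithLp.toLp 2 (Sum.elim
      (fun i => p.2 (Sum.inl i.succ) + Pi.single (M := fun _ => ℝ) 0 (σ.d (D.s₂ p)) i)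
      fun i => p.2 (Sum.inr i.succ)))

/-- The wrapping map, which uses at each point the shear belonging to its position on the
ellipses. -/
def wrap (p : R2 1 × R2 (N + 2)) : R2 2 × R2 (N + 1) := D.wrapWith (D.shear (D.angle p)) p

variable {D}

lemma wrapWith_eq_of_eqAt (h : σ.EqAt τ (D.s₂ p)) : D.wrapWith σ p = D.wrapWith τ p := by
  simp only [wrapWith, Shear.rotation, h.c.eq_of_nhds, h.d.eq_of_nhds, h.e.eq_of_nhds,
    h.c.deriv_eq, h.d.deriv_eq]

lemma exists_wrap_eventuallyEq (hp : p ∈ D.domain N) : ∃ σ, D.wrap =ᶠ[𝓝 p] D.wrapWith σ := by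
  obtain ⟨σ, hσ⟩ := D.exists_shear_eqAt (s₂_lt_of_sin_eq hp) (lt_s₂_of_sin_eq hp)
  have hcont : Tendsto (fun q => (D.angle q, D.s₂ q)) (𝓝 p) (𝓝 (D.angle p) ×ˢ 𝓝 (D.s₂ p)) :=
    (D.contDiff_angle.continuous.tendsto p).prodMk (contDiffAt_s₂ hp).continuousAt
  exact ⟨σ, (hcont.eventually hσ).mono fun q hq => wrapWith_eq_of_eqAt hq⟩

lemma add_c_pos (hp : p ∈ D.domain N) (σ : Shear) : 0 < D.s₁ p + σ.c (D.s₂ p) :=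
  add_pos_of_pos_of_nonneg (s₁_mem_Ioo hp).1 (σ.c_nonneg _)

lemma contDiffAt_add_c (hp : p ∈ D.domain N) (σ : Shear) :
    ContDiffAt ℝ ∞ (fun q => D.s₁ q + σ.c (D.s₂ q)) p :=
  (contDiffAt_s₁ hp).add (σ.contDiff_c.contDiffAt.comp p (contDiffAt_s₂ hp))

lemma contDiffAt_add_rotation (hp : p ∈ D.domain N) (σ : Shear) :
    ContDiffAt ℝ ∞
      (fun q => D.t₂ q + σ.rotation (D.t₁ q) (D.s₂ q) (q.2 (Sum.inr 1))) p := by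
  have hs₂ := contDiffAt_s₂ hp
  have hc := (contDiff_infty_iff_deriv.1 σ.contDiff_c).2.contDiffAt.comp p hs₂
  have hd := (contDiff_infty_iff_deriv.1 σ.contDiff_d).2.contDiffAt.comp p hs₂
  exact (contDiffAt_t₂ hp).add (((hc.neg.mul (contDiffAt_t₁ hp)).sub
    (hd.mul (by fun_prop))).add (σ.contDiff_e.contDiffAt.comp p hs₂))

lemma contDiffAt_wrapWith (hp : p ∈ D.domain N) (σ : Shear) :
    ContDiffAt ℝ ∞ (D.wrapWith σ) p := by
  have hs₂ := contDiffAt_s₂ hp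
  refine ContDiffAt.prodMk (contDiffAt_euclidean.2 ?_) (contDiffAt_euclidean.2 ?_)
  · rintro (i | i) <;> fin_cases i
    · exact contDiffAt_polarX (contDiffAt_add_c hp σ) (contDiffAt_t₁ hp) (add_c_pos hp σ)
    · exact contDiffAt_polarX hs₂ (contDiffAt_add_rotation hp σ) (s₂_mem_Ioo hp).1
    · exact contDiffAt_polarY (contDiffAt_add_c hp σ) (contDiffAt_t₁ hp) (add_c_pos hp σ)
    · exact contDiffAt_polarY hs₂ (contDiffAt_add_rotation hp σ) (s₂_mem_Ioo hp).1
  · have hd := σ.contDiff_d.contDiffAt.comp p hs₂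
    rintro (i | i)
    · cases i using Fin.cases with
      | zero => simpa using ContDiffAt.add (by fun_prop) hd
      | succ i => simp only [Sum.elim_inl, Pi.single_eq_of_ne (Fin.succ_ne_zero i)]; fun_prop
    · simp only [Sum.elim_inr]; fun_prop

lemma contDiffAt_wrap (hp : p ∈ D.domain N) : ContDiffAt ℝ ∞ D.wrap p := by
  obtain ⟨σ, hσ⟩ := exists_wrap_eventuallyEq hp
  exact (contDiffAt_wrapWith hp σ).congr_of_eventuallyEq hσ

lemma prodForm_fderiv_wrapWith (hp : p ∈ D.domain N) (σ : Shear) (u v : R2 1 × R2 (N + 2)) :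
    prodForm (fderiv ℝ (D.wrapWith σ) p u) (fderiv ℝ (D.wrapWith σ) p v) = prodForm u v := by
  have hdiff {f : R2 1 × R2 (N + 2) → ℝ} (hf : ContDiffAt ℝ ∞ f p) : DifferentiableAt ℝ f p :=
    hf.differentiableAt (by simp)
  have hs₂ := hdiff (contDiffAt_s₂ hp)
  have ht₁ := hdiff (contDiffAt_t₁ hp)
  have hfirst := wedge_polar (hdiff (contDiffAt_add_c hp σ)) ht₁ (add_c_pos hp σ) u v
  have hsecond := wedge_polar hs₂ (hdiff (contDiffAt_add_rotation hp σ)) (s₂_mem_Ioo hp).1 u v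
  have hshear := wedge_shear σ.contDiff_c σ.contDiff_d σ.contDiff_e (hdiff (contDiffAt_s₁ hp)) ht₁
    hs₂ (hdiff (contDiffAt_t₂ hp)) (by fun_prop : DifferentiableAt ℝ
      (fun q : R2 1 × R2 (N + 2) => q.2 (Sum.inl 1)) p)
    (by fun_prop : DifferentiableAt ℝ (fun q : R2 1 × R2 (N + 2) => q.2 (Sum.inr 1)) p) u v
  rw [wedge_s₁_t₁ hp, wedge_s₂_t₂ hp] at hshear
  rw [prodForm_fderiv ((contDiffAt_wrapWith hp σ).differentiableAt (by simp)),
    prodForm_eq_sum_wedge p, Fin.sum_univ_two, Fin.sum_univ_one, Fin.sum_univ_succ,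
    Fin.sum_univ_succ, Fin.sum_univ_succ]
  simp only [Shear.rotation] at hsecond
  simp only [wrapWith, Shear.rotation, Sum.elim_inl, Sum.elim_inr, Matrix.cons_val_zero,
    Matrix.cons_val_one, Fin.succ_zero_eq_one, Pi.single_eq_same,
    Pi.single_eq_of_ne (Fin.succ_ne_zero _), add_zero]
  linear_combination hfirst + hsecond + hshear

lemma prodForm_fderiv_wrap (hp : p ∈ D.domain N) (u v : R2 1 × R2 (N + 2)) :
    prodForm (fderiv ℝ D.wrap p u) (fderiv ℝ D.wrap p v) = prodForm u v := by
  obtain ⟨σ, hσ⟩ := exists_wrap_eventuallyEq hp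
  rw [hσ.fderiv_eq]
  exact prodForm_fderiv_wrapWith hp σ u v

variable (D) in
lemma shear_c_le_lift (X s : ℝ) : (D.shear X).c s ≤ D.lift s := by
  rw [shear]
  split_ifs
  exacts [D.lift_nonneg s, le_rfl]

lemma norm_sq_fst_wrapWith (hp : p ∈ D.domain N) (σ : Shear) :
    ‖(D.wrapWith σ p).1‖ ^ 2 = 2 * (D.s₁ p + (D.s₂ p + σ.c (D.s₂ p))) := by
  have hdisc := polarX_sq_add_polarY_sq (add_c_pos hp σ).le (D.t₁ p)
  have hplane := polarX_sq_add_polarY_sq (s₂_mem_Ioo hp).1.le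
    (D.t₂ p + σ.rotation (D.t₁ p) (D.s₂ p) (p.2 (Sum.inr 1)))
  rw [EuclideanSpace.real_norm_sq_eq, Fintype.sum_sum_type, Fin.sum_univ_two, Fin.sum_univ_two]
  simp only [wrapWith, Sum.elim_inl, Sum.elim_inr, Matrix.cons_val_zero, Matrix.cons_val_one]
  linarith

lemma fst_wrap_mem_ball (hR : 0 < R) (hp : p ∈ D.domain N) : (D.wrap p).1 ∈ Metric.ball 0 R := by
  rw [mem_ball_zero_iff]
  refine lt_of_pow_lt_pow_left₀ 2 hR.le ?_
  rw [wrap, norm_sq_fst_wrapWith hp]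
  linarith [(s₁_mem_Ioo hp).2, D.shear_c_le_lift (D.angle p) (D.s₂ p),
    D.add_lift_le (s₂_mem_Ioo hp).2.le]

lemma disc_coordinates_of_wrapWith_eq (hp : p ∈ D.domain N) (hq : q ∈ D.domain N)
    (h : D.wrapWith σ p = D.wrapWith τ q) :
    D.s₁ p + σ.c (D.s₂ p) = D.s₁ q + τ.c (D.s₂ q) ∧ D.t₁ p = D.t₁ q := by
  have hX := congr($h.1 (Sum.inl 0))
  have hY := congr($h.1 (Sum.inr 0))
  obtain ⟨hs₁, k, hk⟩ := polar_injective (add_c_pos hp σ) (add_c_pos hq τ) hX hY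
  have ht₁p := t₁_mem_Ioo hp
  have ht₁q := t₁_mem_Ioo hq
  have hk0 : k = 0 := eq_zero_of_abs_int_mul_lt (a := 2 * π)
    (by rw [abs_lt]; constructor <;> linarith [ht₁p.1, ht₁p.2, ht₁q.1, ht₁q.2])
  exact ⟨hs₁, by simpa [hk0] using hk.symm⟩

lemma plane_coordinates_of_wrapWith_eq (hp : p ∈ D.domain N) (hq : q ∈ D.domain N)
    (h : D.wrapWith σ p = D.wrapWith τ q) :
    D.s₂ p = D.s₂ q ∧ ∃ k : ℤ,
      D.t₂ q + τ.rotation (D.t₁ q) (D.s₂ q) (q.2 (Sum.inr 1)) =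
        D.t₂ p + σ.rotation (D.t₁ p) (D.s₂ p) (p.2 (Sum.inr 1)) + k * (2 * π) :=
  polar_injective (s₂_mem_Ioo hp).1 (s₂_mem_Ioo hq).1 congr($h.1 (Sum.inl 1))
    congr($h.1 (Sum.inr 1))

-- Where `sep` is constant, the coordinates `t₂` of two points on the back and on the front differ,
-- and by less than a full angle; elsewhere the lift is full and the coordinates `s₁` differ.
lemma not_cos_nonneg_of_wrap_eq (hp : p ∈ D.domain N) (hq : q ∈ D.domain N)
    (h : D.wrap p = D.wrap q) (hcos : cos (D.angle p) < 0) : ¬0 ≤ cos (D.angle q) := by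
  intro hcos'
  have hback : D.shear (D.angle p) = D.back _ := if_pos hcos
  have hfront : D.shear (D.angle q) = D.front _ := if_neg hcos'.not_gt
  rw [wrap, wrap, hback, hfront] at h
  obtain ⟨hs₁, -⟩ := disc_coordinates_of_wrapWith_eq hp hq h
  obtain ⟨hs₂, k, hk⟩ := plane_coordinates_of_wrapWith_eq hp hq h
  by_cases hsep : deriv D.sep (D.s₂ p) = 0
  · have ht₂p := abs_lt.1 (abs_t₂_lt hp)
    have ht₂q := abs_lt.1 (abs_t₂_lt hq)
    have hneg := not_le.1 (mt (t₂_nonneg_iff hp).1 hcos.not_ge)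
    have hnonneg := (t₂_nonneg_iff hq).2 hcos'
    have hrot := D.front_rotation_mem (turnIndex (D.angle q)) (t₁_mem_Ioo hq) (D.s₂ q)
      (q.2 (Sum.inr 1))
    rw [back_rotation, hsep, zero_mul, add_zero] at hk
    have hk0 : k = 0 := eq_zero_of_abs_int_mul_lt (a := 2 * π)
      (by rw [abs_lt]; constructor <;> linarith [hrot.1, hrot.2, pi_pos])
    rw [hk0, Int.cast_zero, zero_mul] at hk
    linarith [hrot.1]
  · have hlift := D.lift_eq_of_deriv_sep_ne_zero hsep
    simp only [back, front, ← hs₂, hlift] at hs₁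
    linarith [(s₁_mem_Ioo hp).2, (s₁_mem_Ioo hq).1]

lemma cos_angle_neg_iff_of_wrap_eq (hp : p ∈ D.domain N) (hq : q ∈ D.domain N)
    (h : D.wrap p = D.wrap q) : cos (D.angle p) < 0 ↔ cos (D.angle q) < 0 :=
  ⟨fun hcos => not_le.1 (not_cos_nonneg_of_wrap_eq hp hq h hcos),
    fun hcos => not_le.1 (not_cos_nonneg_of_wrap_eq hq hp h.symm hcos)⟩

variable (D) in
lemma shear_d_sub_shear_d {X Y : ℝ} (h : cos X < 0 ↔ cos Y < 0) (s : ℝ) :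
    (D.shear X).d s - (D.shear Y).d s = (turnIndex X - turnIndex Y : ℤ) * (2 * T) := by
  by_cases hY : cos Y < 0
  · simp only [shear, if_pos hY, if_pos (h.2 hY), back]
    push_cast
    ring
  · simp only [shear, if_neg hY, if_neg (mt h.1 hY), front]
    push_cast
    ring

lemma turnIndex_angle_eq_of_wrap_eq (hp : p ∈ D.domain N) (hq : q ∈ D.domain N)
    (h : D.wrap p = D.wrap q) : turnIndex (D.angle p) = turnIndex (D.angle q) := by
  have hx : p.2 (Sum.inl 1) + (D.shear (D.angle p)).d (D.s₂ p) =
      q.2 (Sum.inl 1) + (D.shear (D.angle q)).d (D.s₂ q) := congr($h.2 (Sum.inl 0))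
  have hd := D.shear_d_sub_shear_d (cos_angle_neg_iff_of_wrap_eq hp hq h) (D.s₂ p)
  rw [← (plane_coordinates_of_wrapWith_eq hp hq h).1] at hx
  have hxp := abs_lt.1 (abs_snd_lt hp (Sum.inl 1))
  have hxq := abs_lt.1 (abs_snd_lt hq (Sum.inl 1))
  exact sub_eq_zero.1 (eq_zero_of_abs_int_mul_lt (a := 2 * T)
    (by rw [← hd, abs_lt]; constructor <;> linarith))

lemma eq_of_wrapWith_eq (hp : p ∈ D.domain N) (hq : q ∈ D.domain N)
    (hturn : turnIndex (D.angle p) = turnIndex (D.angle q))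
    (h : D.wrapWith σ p = D.wrapWith σ q) : p = q := by
  obtain ⟨hs₁, ht₁⟩ := disc_coordinates_of_wrapWith_eq hp hq h
  obtain ⟨hs₂, k, hk⟩ := plane_coordinates_of_wrapWith_eq hp hq h
  have hy (i : Fin (N + 1)) : p.2 (Sum.inr i.succ) = q.2 (Sum.inr i.succ) :=
    congr($h.2 (Sum.inr i))
  have hy₃ : p.2 (Sum.inr 1) = q.2 (Sum.inr 1) := hy 0
  rw [ht₁, hs₂, hy₃, add_right_comm, add_left_inj] at hk
  have hk0 : k = 0 := by
    have ht₂p := abs_lt.1 (abs_t₂_lt hp)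
    have ht₂q := abs_lt.1 (abs_t₂_lt hq)
    have hθ : 0 ≤ π * D.θ := mul_nonneg pi_pos.le D.θ_nonneg
    exact eq_zero_of_abs_int_mul_lt (a := 2 * π) (by rw [abs_lt]; constructor <;> linarith)
  refine eq_of_coordinates_eq hp hq ?_ ht₁ hs₂ ?_ hturn (fun i => ?_) hy
  · rwa [hs₂, add_left_inj] at hs₁
  · rw [hk, hk0, Int.cast_zero, zero_mul, add_zero]
  · have hx := congr($h.2 (Sum.inl i))
    simpa only [wrapWith, Sum.elim_inl, hs₂, add_left_inj] using hx

lemma injOn_wrap : InjOn D.wrap (D.domain N) := by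
  intro p hp q hq h
  have hturn := turnIndex_angle_eq_of_wrap_eq hp hq h
  have hshear : D.shear (D.angle p) = D.shear (D.angle q) := by
    simp only [shear, hturn, cos_angle_neg_iff_of_wrap_eq hp hq h]
  rw [wrap, wrap, hshear] at h
  exact eq_of_wrapWith_eq hp hq hturn h

variable (D) in
lemma isSymplecticEmbeddingOn_wrap : IsSymplecticEmbeddingOn D.wrap (D.domain N) :=
  isSymplecticEmbeddingOn_of_injOn (by omega) (Metric.isOpen_ball.prod Metric.isOpen_ball)
    (fun _ => contDiffAt_wrap) (fun _ => prodForm_fderiv_wrap) injOn_wrap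

end WrappingData

end

/-- For `n ≥ 3`, `R > √3` and `S > 0`, the product `B²(1) × B²⁽ⁿ⁻¹⁾(S)` of closed balls embeds
symplectically into `B⁴(R) × ℝ²⁽ⁿ⁻²⁾`, with `B⁴(R)` the open ball. -/
theorem mainTheorem3 (n : ℕ) (hn : 3 ≤ n) (R : ℝ) (hR : √3 < R) (S : ℝ) (hS : 0 < S) :
    SymplecticallyEmbeds
      (Metric.closedBall (0 : R2 1) 1 ×ˢ Metric.closedBall (0 : R2 (n - 1)) S)
      (Metric.ball (0 : R2 2) R ×ˢ (Set.univ : Set (R2 (n - 2)))) := by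
  obtain ⟨N, rfl⟩ := Nat.exists_eq_add_of_le' hn
  obtain ⟨D⟩ := exists_wrappingData hR (by positivity : 0 < S + 1)
  have hsub : Metric.closedBall (0 : R2 1) 1 ×ˢ Metric.closedBall (0 : R2 (N + 2)) S ⊆
      D.domain N :=
    Set.prod_mono (Metric.closedBall_subset_ball D.one_lt_ρ)
      (Metric.closedBall_subset_ball (lt_add_one S))
  have hR0 : 0 < R := (Real.sqrt_nonneg 3).trans_lt hR
  exact ⟨D.domain N, D.wrap, hsub, D.isSymplecticEmbeddingOn_wrap,
    fun p hp => ⟨WrappingData.fst_wrap_mem_ball hR0 (hsub hp), Set.mem_univ _⟩⟩
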